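/- Fix $d\in\mathbb N$ and $\theta>0$, let $k(x,x')=\exp(-\theta\|x-x'\|_2^2)$ be the Gaussian kernel on $\mathbb R^d$, and let $\mathscr H$ be its reproducing kernel Hilbert space. For Borel probability measures $\mathbb P,\mathbb Q$ on $\mathbb R^d$ put $\mathrm{MMD}(\mathbb P,\mathbb Q)=\big\|\int k(z,\cdot)\,d\mathbb P(z)-\int k(z,\cdot)\,d\mathbb Q(z)\big\|_{\mathscr H}$, and for finite samples $\mathbf H=(h_1,\dots,h_p)$, $\mathbf D=(d_1,\dots,d_m)$ in $\mathbb R^d$ put $\mathrm{MMD}(\mathbf H,\mathbf D)=\big\|\frac1p\sum_{a=1}^p k(h_a,\cdot)-\frac1m\sum_{b=1}^m k(d_b,\cdot)\big\|_{\mathscr H}$. Let $G_1,\dots,G_N$ be training graphs with class labels $y_1,\dots,y_N\in\{1,\dots,K\}$, where the number of classes satisfies $K\le N$ (for instance, because every class has at least one training graph). Let graph $G_i$ have $n_i\ge 1$ nodes, let $n=\min_i n_i$, let $m\ge 1$ and $\delta>0$. Let $\mathbb P_1,\dots,\mathbb P_K$ be Borel probability measures on $\mathbb R^d$ (the class distributions).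 Suppose that, for each $i$, the $n_i$ rows of the node embedding $\mathbf H_i$ of $G_i$ are independent with law $\mathbb P_{y_i}$, and that, for each $k$, the $m$ rows of the reference $\mathbf D_k$ are independent with law $\mathbb P_k$; nothing is assumed about the joint law of different embeddings and references. Graph $G_i$ is classified correctly if $\mathrm{MMD}(\mathbf H_i,\mathbf D_{y_i})<\mathrm{MMD}(\mathbf H_i,\mathbf D_j)$ for every $j\ne y_i$. If $$\min_{i\neq j}\mathrm{MMD}(\mathbb P_i,\mathbb P_j)>\Big(\frac1{\sqrt m}+\frac1{\sqrt n}\Big)\Big(4+4\sqrt{\log\frac{2N}{\delta}}\Big),$$ then with probability at least $1-\delta$ all the graphs $G_1,\dots,G_N$ are classified correctly. (For $\delta\geq 1$ this is void.) -/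

import Mathlib

open MeasureTheory ProbabilityTheory
open scoped NNReal

namespace GRDL

noncomputable section

/-! ### The Gaussian kernel and its reproducing kernel Hilbert space -/

/-- The Gaussian kernel `k(x, y) = exp (-θ ‖x - y‖²)` on `ℝᵈ`. A scalar kernel is regarded as a
kernel with values in the continuous linear maps `ℝ → ℝ` (multiplication by the scalar). -/
def gaussianKernel (d : ℕ) (θ : ℝ≥0) :
    Matrix (EuclideanSpace ℝ (Fin d)) (EuclideanSpace ℝ (Fin d)) (ℝ →L[ℝ] ℝ) :=
  Matrix.of fun x y => Real.exp (-(θ : ℝ) * ‖x - y‖ ^ 2) • ContinuousLinearMap.id ℝ ℝ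

theorem gaussianKernel_apply (d : ℕ) (θ : ℝ≥0) (x y : EuclideanSpace ℝ (Fin d)) (v : ℝ) :
    gaussianKernel d θ x y v = Real.exp (-(θ : ℝ) * ‖x - y‖ ^ 2) * v := rfl

/-- The Gaussian kernel is the characteristic function of a Gaussian measure. -/
theorem exp_eq_integral_cos (d : ℕ) (θ : ℝ≥0) (x y : EuclideanSpace ℝ (Fin d)) :
    Real.exp (-(θ : ℝ) * ‖x - y‖ ^ 2) =
      ∫ t, Real.cos (inner ℝ t (Real.sqrt (2 * θ) • (x - y)))
        ∂(stdGaussian (EuclideanSpace ℝ (Fin d))) := by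
  have h := charFun_stdGaussian (E := EuclideanSpace ℝ (Fin d)) (Real.sqrt (2 * θ) • (x - y))
  rw [charFun_apply] at h
  have hint : Integrable (fun t : EuclideanSpace ℝ (Fin d) =>
      Complex.exp ((inner ℝ t (Real.sqrt (2 * θ) • (x - y)) : ℝ) * Complex.I))
      (stdGaussian (EuclideanSpace ℝ (Fin d))) := by
    refine Integrable.of_bound (C := 1) (by fun_prop) (ae_of_all _ fun t => ?_)
    rw [Complex.norm_exp_ofReal_mul_I]
  have h2 := congrArg Complex.re h
  have h3 : (∫ t, Complex.exp ((inner ℝ t (Real.sqrt (2 * θ) • (x - y)) : ℝ) * Complex.I)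
      ∂(stdGaussian (EuclideanSpace ℝ (Fin d)))).re = ∫ t,
      (Complex.exp ((inner ℝ t (Real.sqrt (2 * θ) • (x - y)) : ℝ) * Complex.I)).re
      ∂(stdGaussian (EuclideanSpace ℝ (Fin d))) := by
    simpa using (integral_re hint).symm
  rw [h3] at h2
  simp only [Complex.exp_ofReal_mul_I_re] at h2
  have h4 : ‖Real.sqrt (2 * θ) • (x - y)‖ ^ 2 = 2 * θ * ‖x - y‖ ^ 2 := by
    rw [norm_smul, Real.norm_of_nonneg (Real.sqrt_nonneg _), mul_pow, Real.sq_sqrt (by positivity)]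
  have h5 : (-(‖Real.sqrt (2 * θ) • (x - y)‖ : ℂ) ^ 2 / 2) =
      ((-(θ : ℝ) * ‖x - y‖ ^ 2 : ℝ) : ℂ) := by
    rw [← Complex.ofReal_pow, h4]
    push_cast
    ring
  rw [h2, h5, Complex.exp_ofReal_re]

/-- The Gaussian kernel is positive semidefinite. -/
theorem posSemidef_gaussianKernel (d : ℕ) (θ : ℝ≥0) : (gaussianKernel d θ).PosSemidef := by
  have tf := (RKHS.posSemidef_tfae (K := gaussianKernel d θ)).out 0 2
  rw [tf]
  refine ⟨?_, fun w => ?_⟩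
  · ext x y
    simp [Matrix.conjTranspose_apply, gaussianKernel, norm_sub_rev y x,
      ← ContinuousLinearMap.one_def]
  · set γ := stdGaussian (EuclideanSpace ℝ (Fin d))
    set s : ℝ := Real.sqrt (2 * θ)
    have hc : ∀ x : EuclideanSpace ℝ (Fin d), ∀ y : EuclideanSpace ℝ (Fin d),
        Integrable (fun t => Real.cos (inner ℝ t (s • (x - y)))) γ := fun x y =>
      Integrable.of_bound (C := 1) (by fun_prop) (ae_of_all _ fun t => Real.abs_cos_le_one _)
    have key : (w.sum fun x a => w.sum fun y b => inner ℝ (gaussianKernel d θ y x a) b) =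
        ∫ t, ((∑ x ∈ w.support, w x * Real.cos (inner ℝ t (s • x))) ^ 2 +
          (∑ x ∈ w.support, w x * Real.sin (inner ℝ t (s • x))) ^ 2) ∂γ := by
      have hpt : ∀ t : EuclideanSpace ℝ (Fin d),
          (∑ x ∈ w.support, w x * Real.cos (inner ℝ t (s • x))) ^ 2 +
          (∑ x ∈ w.support, w x * Real.sin (inner ℝ t (s • x))) ^ 2 =
          ∑ x ∈ w.support, ∑ y ∈ w.support,
            w x * w y * Real.cos (inner ℝ t (s • (y - x))) := by
        intro t
        rw [pow_two, pow_two, Finset.sum_mul_sum, Finset.sum_mul_sum, ← Finset.sum_add_distrib]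
        refine Finset.sum_congr rfl fun x _ => ?_
        rw [← Finset.sum_add_distrib]
        refine Finset.sum_congr rfl fun y _ => ?_
        rw [smul_sub, inner_sub_right, Real.cos_sub]
        ring
      simp only [hpt]
      rw [integral_finsetSum _ fun x _ => integrable_finsetSum _ fun y _ =>
        (hc y x).const_mul _]
      refine Finset.sum_congr rfl fun x _ => ?_
      rw [integral_finsetSum _ fun y _ => (hc y x).const_mul _]
      refine Finset.sum_congr rfl fun y _ => ?_
      rw [integral_const_mul, ← exp_eq_integral_cos]
      simp only [gaussianKernel_apply, RCLike.inner_apply, conj_trivial]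
      ring
    have hnn : 0 ≤ (w.sum fun x a => w.sum fun y b =>
        inner ℝ (gaussianKernel d θ y x a) b) := by
      rw [key]
      exact integral_nonneg fun t => by positivity
    simpa using hnn

instance factPosSemidef (d : ℕ) (θ : ℝ≥0) : Fact (gaussianKernel d θ).PosSemidef :=
  ⟨posSemidef_gaussianKernel d θ⟩

/-- The reproducing kernel Hilbert space of the Gaussian kernel on `ℝᵈ`. -/
abbrev GaussianRKHS (d : ℕ) (θ : ℝ≥0) : Type := RKHS.OfKernel (gaussianKernel d θ)

/-- The canonical feature map `φ(x) = k(x, ·)`. -/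
def feature (d : ℕ) (θ : ℝ≥0) (x : EuclideanSpace ℝ (Fin d)) : GaussianRKHS d θ :=
  RKHS.kerFun (GaussianRKHS d θ) x 1

/-! ### Maximum mean discrepancy -/

/-- The kernel mean embedding `∫ k(z, ·) dP(z)` of a measure `P` on `ℝᵈ`. -/
def meanEmbedding {d : ℕ} (θ : ℝ≥0) (P : Measure (EuclideanSpace ℝ (Fin d))) :
    GaussianRKHS d θ :=
  ∫ z, feature d θ z ∂P

/-- The empirical mean embedding `n⁻¹ ∑ₐ k(zₐ, ·)` of a finite sample `z₁, …, zₙ`. -/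
def empiricalEmbedding {d n : ℕ} (θ : ℝ≥0) (z : Fin n → EuclideanSpace ℝ (Fin d)) :
    GaussianRKHS d θ :=
  (1 / (n : ℝ)) • ∑ a, feature d θ (z a)

/-- The maximum mean discrepancy between two distributions. -/
def mmd {d : ℕ} (θ : ℝ≥0) (P Q : Measure (EuclideanSpace ℝ (Fin d))) : ℝ :=
  ‖meanEmbedding θ P - meanEmbedding θ Q‖

/-- The (biased) empirical maximum mean discrepancy between two finite samples. -/
def empiricalMMD {d n m : ℕ} (θ : ℝ≥0) (H : Fin n → EuclideanSpace ℝ (Fin d))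
    (D : Fin m → EuclideanSpace ℝ (Fin d)) : ℝ :=
  ‖empiricalEmbedding θ H - empiricalEmbedding θ D‖

/-- A node embedding `H` belonging to class `k` is correctly classified by the references
`D₁, …, D_K` if its discrepancy to `D_k` is strictly smaller than to every other reference. -/
def CorrectlyClassified {d n m K : ℕ} (θ : ℝ≥0) (D : Fin K → Fin m → EuclideanSpace ℝ (Fin d))
    (H : Fin n → EuclideanSpace ℝ (Fin d)) (k : Fin K) : Prop :=
  ∀ j, j ≠ k → empiricalMMD θ H (D k) < empiricalMMD θ H (D j)

/-- `X₁, …, Xₙ` is an independent and identically distributed sample from `P`. -/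
def IsIIDSample {Ω : Type*} [MeasurableSpace Ω] (μ : Measure Ω) {d n : ℕ}
    (P : Measure (EuclideanSpace ℝ (Fin d))) (X : Fin n → Ω → EuclideanSpace ℝ (Fin d)) : Prop :=
  (∀ a, HasLaw (X a) P μ) ∧ iIndepFun X μ

end

end GRDL

/-! A graph is classified correctly once its empirical embedding and all reference embeddings lie
close enough to their population means: the triangle inequality then carries the separation of the
classes over to the samples (`correctlyClassified_of_norm_lt`). A union bound over the `N + K ≤ 2N`
samples needs no joint independence, so each sample may fail with probability `δ / (2N)`.

One sample is controlled by Pinelis' inequality: for centred bounded vectors in a Hilbert space,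
adding an independent summand multiplies the expectation of `cosh ‖·‖` by at most `cosh b`, and
Markov's inequality gives a dimension-free sub-Gaussian tail. Centred features have norm at most
`√2`, not merely `2`, because the kernel is nonnegative; this gives the exponent `n t² / 4` that the
stated constants require. -/

/-- Convexity of `x ↦ cosh √x`, in the form used in Pinelis' inequality. -/
theorem Real.cosh_le_cosh_mul_cosh_add {a b x u : ℝ} (hx₁ : -1 ≤ x) (hx₂ : x ≤ 1)
    (hu : u ^ 2 ≤ a ^ 2 + b ^ 2 + 2 * a * b * x) :
    Real.cosh u ≤ Real.cosh a * Real.cosh b + x * (Real.sinh a * Real.sinh b) := by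
  have hsum : Real.cosh a * Real.cosh b + x * (Real.sinh a * Real.sinh b) =
      (1 + x) / 2 * Real.cosh (a + b) + (1 - x) / 2 * Real.cosh (a - b) := by
    rw [Real.cosh_add, Real.cosh_sub]
    ring
  rw [hsum]
  -- Compare power series in the squared argument: the coefficients are nonnegative and each `t ↦ t
  -- ^ k` is convex on `t ≥ 0`.
  refine hasSum_le (fun k => ?_) (Real.hasSum_cosh u)
    (((Real.hasSum_cosh (a + b)).mul_left ((1 + x) / 2)).add
      ((Real.hasSum_cosh (a - b)).mul_left ((1 - x) / 2)))
  rw [← mul_div_assoc, ← mul_div_assoc, ← add_div]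
  gcongr
  have hconv := (convexOn_pow (𝕜 := ℝ) k).2 (Set.mem_Ici.2 (sq_nonneg (a + b)))
    (Set.mem_Ici.2 (sq_nonneg (a - b))) (by linarith : 0 ≤ (1 + x) / 2)
    (by linarith : 0 ≤ (1 - x) / 2) (by ring)
  simp only [smul_eq_mul] at hconv
  rw [pow_mul, pow_mul, pow_mul]
  refine le_trans (pow_le_pow_left₀ (sq_nonneg u) ?_ k) hconv
  linarith

/-! ### Pinelis' inequality in a Hilbert space -/

section Pinelis

variable {F : Type*} [NormedAddCommGroup F] [InnerProductSpace ℝ F]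

/-- The bound is affine in `v`, so its linear term vanishes on averaging over a centred `v`. For `s
= 0`, division by zero makes that term `0`, which is the right value. -/
theorem cosh_norm_add_le {s v : F} {b : ℝ} (hb : 0 < b) (hv : ‖v‖ ≤ b) :
    Real.cosh ‖s + v‖ ≤ Real.cosh ‖s‖ * Real.cosh b +
      inner ℝ s v * (Real.sinh ‖s‖ * Real.sinh b / (‖s‖ * b)) := by
  have hinner : |inner ℝ s v| ≤ ‖s‖ * b :=
    (abs_real_inner_le_norm s v).trans (by gcongr)
  have hrhs : inner ℝ s v * (Real.sinh ‖s‖ * Real.sinh b / (‖s‖ * b)) =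
      inner ℝ s v / (‖s‖ * b) * (Real.sinh ‖s‖ * Real.sinh b) := by ring
  rw [hrhs]
  have habs : |inner ℝ s v / (‖s‖ * b)| ≤ 1 := by
    rw [abs_div, abs_of_nonneg (a := ‖s‖ * b) (by positivity)]
    exact div_le_one_of_le₀ hinner (by positivity)
  refine Real.cosh_le_cosh_mul_cosh_add (abs_le.1 habs).1 (abs_le.1 habs).2 ?_
  have hcancel : 2 * ‖s‖ * b * (inner ℝ s v / (‖s‖ * b)) = 2 * inner ℝ s v := by
    rcases eq_or_ne s 0 with rfl | hs
    · simp
    · have := norm_ne_zero_iff.2 hs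
      field_simp
  rw [hcancel, norm_add_sq_real]
  have : ‖v‖ ^ 2 ≤ b ^ 2 := by gcongr
  linarith

variable {E : Type*} [MeasurableSpace E]

omit [InnerProductSpace ℝ F] in
theorem integrable_cosh_norm {ρ : Measure E} [IsFiniteMeasure ρ] {f : E → F} {C : ℝ}
    (hf : AEStronglyMeasurable f ρ) (hC : ∀ z, ‖f z‖ ≤ C) :
    Integrable (fun z => Real.cosh ‖f z‖) ρ := by
  refine Integrable.of_bound (C := Real.cosh C)
    (Real.continuous_cosh.comp_aestronglyMeasurable hf.norm) (ae_of_all _ fun z => ?_)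
  rw [Real.norm_of_nonneg (Real.cosh_pos _).le, Real.cosh_le_cosh, abs_norm]
  exact (hC z).trans (le_abs_self C)

variable [CompleteSpace F]

theorem integral_cosh_norm_add_le {Q : Measure E} [IsProbabilityMeasure Q] {g : E → F} {b : ℝ}
    (hg : StronglyMeasurable g) (hb : 0 < b) (hgb : ∀ z, ‖g z‖ ≤ b) (hg0 : ∫ z, g z ∂Q = 0)
    (s : F) : ∫ z, Real.cosh ‖s + g z‖ ∂Q ≤ Real.cosh ‖s‖ * Real.cosh b := by
  have hgi : Integrable g Q := .of_bound hg.aestronglyMeasurable b (ae_of_all _ hgb)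
  have hin : Integrable (fun z => inner ℝ s (g z)) Q := hgi.const_inner s
  have hle : ∀ z, ‖s + g z‖ ≤ ‖s‖ + b := fun z => (norm_add_le _ _).trans (by grw [hgb z])
  calc ∫ z, Real.cosh ‖s + g z‖ ∂Q
      ≤ ∫ z, (Real.cosh ‖s‖ * Real.cosh b +
          inner ℝ s (g z) * (Real.sinh ‖s‖ * Real.sinh b / (‖s‖ * b))) ∂Q :=
        integral_mono (integrable_cosh_norm
          (stronglyMeasurable_const.add hg).aestronglyMeasurable hle)
          ((integrable_const _).add (hin.mul_const _)) fun z => cosh_norm_add_le hb (hgb z)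
    _ = Real.cosh ‖s‖ * Real.cosh b := by
        rw [integral_add (integrable_const _) (hin.mul_const _),
          integral_mul_const (Real.sinh ‖s‖ * Real.sinh b / (‖s‖ * b)), integral_inner hgi, hg0]
        simp

/-- The exponential moment bound behind Pinelis' inequality for i.i.d. sums in a Hilbert space. -/
theorem integral_cosh_norm_add_sum_le {Q : Measure E} [IsProbabilityMeasure Q] {g : E → F} {b : ℝ}
    (hg : StronglyMeasurable g) (hb : 0 < b) (hgb : ∀ z, ‖g z‖ ≤ b) (hg0 : ∫ z, g z ∂Q = 0)
    (n : ℕ) (s : F) :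
    ∫ z, Real.cosh ‖s + ∑ i, g (z i)‖ ∂(Measure.pi fun _ : Fin n => Q) ≤
      Real.cosh ‖s‖ * Real.cosh b ^ n := by
  -- The starting point `s` must vary: after the first summand is split off, the hypothesis is used
  -- at `s + g z`.
  induction n generalizing s with
  | zero => simp
  | succ n ih =>
    have hmp := measurePreserving_piFinSuccAbove (fun _ : Fin (n + 1) => Q) 0
    have hsum : StronglyMeasurable fun p : E × (Fin n → E) => ∑ i, g (p.2 i) :=
      Finset.stronglyMeasurable_fun_sum _ fun i _ => hg.comp_measurable (by fun_prop)
    have hsm : StronglyMeasurable fun p : E × (Fin n → E) => s + g p.1 + ∑ i, g (p.2 i) :=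
      (stronglyMeasurable_const.add (hg.comp_measurable measurable_fst)).add hsum
    have hbd : ∀ p : E × (Fin n → E), ‖s + g p.1 + ∑ i, g (p.2 i)‖ ≤ ‖s‖ + b + n * b := by
      intro p
      refine (norm_add_le _ _).trans (add_le_add ((norm_add_le _ _).trans (by grw [hgb])) ?_)
      refine (norm_sum_le_of_le _ fun i _ => hgb _).trans ?_
      simp
    have hint : Integrable (fun p : E × (Fin n → E) =>
        Real.cosh ‖s + g p.1 + ∑ i, g (p.2 i)‖) (Q.prod (Measure.pi fun _ : Fin n => Q)) :=
      integrable_cosh_norm hsm.aestronglyMeasurable hbd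
    have hint₁ : Integrable (fun z => Real.cosh ‖s + g z‖) Q :=
      integrable_cosh_norm (stronglyMeasurable_const.add hg).aestronglyMeasurable
        fun z => (norm_add_le _ _).trans (by grw [hgb z])
    calc ∫ z, Real.cosh ‖s + ∑ i, g (z i)‖ ∂(Measure.pi fun _ : Fin (n + 1) => Q)
        = ∫ p : E × (Fin n → E), Real.cosh ‖s + g p.1 + ∑ i, g (p.2 i)‖
            ∂(Q.prod (Measure.pi fun _ : Fin n => Q)) := by
          rw [← hmp.integral_comp']
          refine integral_congr_ae (ae_of_all _ fun z => ?_)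
          simp [Fin.sum_univ_succ, add_assoc, MeasurableEquiv.piFinSuccAbove, Fin.tail]
      _ = ∫ z, ∫ w, Real.cosh ‖s + g z + ∑ i, g (w i)‖ ∂(Measure.pi fun _ : Fin n => Q) ∂Q :=
          integral_prod _ hint
      _ ≤ ∫ z, Real.cosh ‖s + g z‖ * Real.cosh b ^ n ∂Q :=
          integral_mono hint.integral_prod_left (hint₁.mul_const _) fun z => ih (s + g z)
      _ ≤ Real.cosh ‖s‖ * Real.cosh b * Real.cosh b ^ n := by
          rw [integral_mul_const]
          have := Real.cosh_pos b
          gcongr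
          exact integral_cosh_norm_add_le hg hb hgb hg0 s
      _ = Real.cosh ‖s‖ * Real.cosh b ^ (n + 1) := by ring

/-- Pinelis' inequality for sums of centred i.i.d. bounded vectors in a Hilbert space. -/
theorem measureReal_le_norm_sum_le {Q : Measure E} [IsProbabilityMeasure Q] {g : E → F} {b : ℝ}
    (hg : StronglyMeasurable g) (hb : 0 < b) (hgb : ∀ z, ‖g z‖ ≤ b) (hg0 : ∫ z, g z ∂Q = 0)
    {n : ℕ} {t : ℝ} (ht : 0 < t) :
    (Measure.pi fun _ : Fin n => Q).real {z | n * t ≤ ‖∑ i, g (z i)‖} ≤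
      2 * Real.exp (-(n * t ^ 2 / (2 * b ^ 2))) := by
  -- This `l` minimises the Chernoff exponent `n (l b)² / 2 - l n t`.
  set l : ℝ := t / b ^ 2 with hl
  have hl0 : 0 < l := by positivity
  have hexp := integral_cosh_norm_add_sum_le (Q := Q) (g := fun z => l • g z) (b := l * b)
    (hg.const_smul l) (by positivity)
    (fun z => by rw [norm_smul, Real.norm_of_nonneg hl0.le]; grw [hgb z])
    (by rw [integral_smul, hg0, smul_zero]) n 0
  simp only [zero_add, norm_zero, Real.cosh_zero, one_mul, ← Finset.smul_sum] at hexp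
  have hsm : StronglyMeasurable fun z : Fin n → E => l • ∑ i, g (z i) :=
    (Finset.stronglyMeasurable_fun_sum _ fun i _ =>
      hg.comp_measurable (measurable_pi_apply i)).const_smul l
  have hint : Integrable (fun z : Fin n → E => Real.cosh ‖l • ∑ i, g (z i)‖)
      (Measure.pi fun _ : Fin n => Q) := by
    refine integrable_cosh_norm (C := l * (n * b)) hsm.aestronglyMeasurable fun z => ?_
    rw [norm_smul, Real.norm_of_nonneg hl0.le]
    gcongr
    refine (norm_sum_le_of_le _ fun i _ => hgb _).trans ?_
    simp
  have hmarkov := mul_meas_ge_le_integral_of_nonneg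
    (ae_of_all _ fun z : Fin n → E => (Real.cosh_pos ‖l • ∑ i, g (z i)‖).le) hint
    (Real.exp (l * (n * t)) / 2)
  -- The factor `2` in the tail comes from `cosh x ≥ exp x / 2`.
  have hsub : (Measure.pi fun _ : Fin n => Q).real {z | n * t ≤ ‖∑ i, g (z i)‖} ≤
      (Measure.pi fun _ : Fin n => Q).real
        {z | Real.exp (l * (n * t)) / 2 ≤ Real.cosh ‖l • ∑ i, g (z i)‖} := by
    refine measureReal_mono fun z (hz : n * t ≤ _) => ?_
    rw [Set.mem_ofPred_eq, norm_smul, Real.norm_of_nonneg hl0.le, Real.cosh_eq]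
    have h₁ : Real.exp (l * (n * t)) ≤ Real.exp (l * ‖∑ i, g (z i)‖) := by gcongr
    have h₂ := Real.exp_pos (-(l * ‖∑ i, g (z i)‖))
    linarith
  have hcosh : Real.cosh (l * b) ^ n ≤ Real.exp (n * ((l * b) ^ 2 / 2)) := by
    rw [Real.exp_nat_mul]
    exact pow_le_pow_left₀ (Real.cosh_pos _).le (Real.cosh_le_exp_half_sq _) n
  have htot := (mul_le_mul_of_nonneg_left hsub (by positivity)).trans
    (hmarkov.trans (hexp.trans hcosh))
  have he : Real.exp (n * ((l * b) ^ 2 / 2)) =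
      Real.exp (l * (n * t)) / 2 * (2 * Real.exp (-(n * t ^ 2 / (2 * b ^ 2)))) := by
    have hhalf : ∀ u v : ℝ, u / 2 * (2 * v) = u * v := fun u v => by ring
    rw [hhalf, ← Real.exp_add]
    congr 1
    rw [hl]
    field_simp
    ring
  rw [he] at htot
  exact le_of_mul_le_mul_left htot (by positivity)

end Pinelis

/-! ### Gaussian features and mean embeddings -/

namespace GRDL

variable {d : ℕ} {θ : ℝ≥0}

theorem inner_feature (x y : EuclideanSpace ℝ (Fin d)) :
    inner ℝ (feature d θ x) (feature d θ y) = Real.exp (-(θ : ℝ) * ‖x - y‖ ^ 2) := by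
  have h := RKHS.kernel_inner (GaussianRKHS d θ) y x (1 : ℝ) 1
  rw [RKHS.OfKernel.kernel_ofKernel, gaussianKernel_apply] at h
  rw [feature, feature, ← h, norm_sub_rev]
  simp

theorem norm_feature (x : EuclideanSpace ℝ (Fin d)) : ‖feature d θ x‖ = 1 := by
  have h := inner_feature (θ := θ) x x
  rw [real_inner_self_eq_norm_sq, sub_self, norm_zero] at h
  rw [← sq_eq_sq₀ (norm_nonneg _) zero_le_one, h]
  simp

/-- Unit norms give `‖φ x - φ y‖² = 2 - 2 k(x, y)`, which tends to `0` as `x → y`. -/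
theorem continuous_feature : Continuous (feature d θ) := by
  have h : ∀ x y, dist (feature d θ x) (feature d θ y) =
      Real.sqrt (2 - 2 * Real.exp (-(θ : ℝ) * ‖x - y‖ ^ 2)) := by
    intro x y
    rw [dist_eq_norm, ← Real.sqrt_sq (norm_nonneg _), norm_sub_sq_real, inner_feature,
      norm_feature, norm_feature]
    congr 1
    ring
  refine continuous_iff_continuousAt.2 fun y => ?_
  rw [ContinuousAt, tendsto_iff_dist_tendsto_zero]
  simp_rw [h]
  have hc : Continuous fun x => Real.sqrt (2 - 2 * Real.exp (-(θ : ℝ) * ‖x - y‖ ^ 2)) := by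
    fun_prop
  simpa using hc.tendsto y

theorem stronglyMeasurable_feature : StronglyMeasurable (feature d θ) :=
  continuous_feature.stronglyMeasurable

theorem integrable_feature (P : Measure (EuclideanSpace ℝ (Fin d))) [IsFiniteMeasure P] :
    Integrable (feature d θ) P :=
  .of_bound stronglyMeasurable_feature.aestronglyMeasurable 1
    (ae_of_all _ fun x => (norm_feature x).le)

theorem norm_meanEmbedding_le (P : Measure (EuclideanSpace ℝ (Fin d))) [IsProbabilityMeasure P] :
    ‖meanEmbedding θ P‖ ≤ 1 := by
  simpa [meanEmbedding] using norm_integral_le_of_norm_le_const (μ := P)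
    (ae_of_all _ fun x => (norm_feature (θ := θ) x).le)

theorem inner_feature_meanEmbedding_nonneg (P : Measure (EuclideanSpace ℝ (Fin d)))
    [IsProbabilityMeasure P] (x : EuclideanSpace ℝ (Fin d)) :
    0 ≤ inner ℝ (feature d θ x) (meanEmbedding θ P) := by
  rw [meanEmbedding, ← integral_inner (integrable_feature P)]
  exact integral_nonneg fun z => by rw [inner_feature]; positivity

/-- In the expanded square the cross term only helps, and the two squared norms are at most `1`. -/
theorem norm_feature_sub_meanEmbedding_le (P : Measure (EuclideanSpace ℝ (Fin d)))
    [IsProbabilityMeasure P] (x : EuclideanSpace ℝ (Fin d)) :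
    ‖feature d θ x - meanEmbedding θ P‖ ≤ Real.sqrt 2 := by
  refine Real.le_sqrt_of_sq_le ?_
  rw [norm_sub_sq_real, norm_feature]
  have h₁ := inner_feature_meanEmbedding_nonneg (θ := θ) P x
  have h₂ : ‖meanEmbedding θ P‖ ^ 2 ≤ 1 := pow_le_one₀ (norm_nonneg _) (norm_meanEmbedding_le P)
  linarith

theorem norm_empiricalEmbedding_sub_meanEmbedding {n : ℕ} (hn : 0 < n)
    (P : Measure (EuclideanSpace ℝ (Fin d))) (z : Fin n → EuclideanSpace ℝ (Fin d)) :
    n * ‖empiricalEmbedding θ z - meanEmbedding θ P‖ =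
      ‖∑ a, (feature d θ (z a) - meanEmbedding θ P)‖ := by
  have hn' : (n : ℝ) ≠ 0 := by positivity
  rw [← Real.norm_natCast n, ← norm_smul, Finset.sum_sub_distrib, smul_sub, empiricalEmbedding,
    smul_smul, mul_one_div_cancel hn', one_smul]
  simp [Nat.cast_smul_eq_nsmul]

/-! ### Concentration and classification -/

variable {Ω : Type*} [MeasurableSpace Ω] {μ : Measure Ω}

/-- Concentration of the empirical kernel mean embedding of an i.i.d. sample. -/
theorem IsIIDSample.measureReal_le [IsProbabilityMeasure μ] {n : ℕ}
    {P : Measure (EuclideanSpace ℝ (Fin d))} [IsProbabilityMeasure P]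
    {X : Fin n → Ω → EuclideanSpace ℝ (Fin d)} (hX : IsIIDSample μ P X) (hn : 0 < n) {t : ℝ}
    (ht : 0 < t) :
    μ.real {ω | t ≤ ‖empiricalEmbedding θ (fun a => X a ω) - meanEmbedding θ P‖} ≤
      2 * Real.exp (-(n * t ^ 2 / 4)) := by
  have hlaw : μ.map (fun ω a => X a ω) = Measure.pi fun _ : Fin n => P := by
    rw [(iIndepFun_iff_map_fun_eq_pi_map fun a => (hX.1 a).aemeasurable).1 hX.2]
    simp_rw [fun a => (hX.1 a).map_eq]
  have hset : MeasurableSet {z : Fin n → EuclideanSpace ℝ (Fin d) |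
      n * t ≤ ‖∑ a, (feature d θ (z a) - meanEmbedding θ P)‖} := by
    refine measurableSet_le measurable_const (Continuous.measurable ?_)
    have := continuous_feature (d := d) (θ := θ)
    fun_prop
  have hpin := measureReal_le_norm_sum_le (Q := P) (n := n)
    (g := fun x => feature d θ x - meanEmbedding θ P) (b := Real.sqrt 2)
    (stronglyMeasurable_feature.sub stronglyMeasurable_const) (by positivity)
    (norm_feature_sub_meanEmbedding_le P)
    (by rw [integral_sub (integrable_feature P) (integrable_const _)]; simp [meanEmbedding]) ht
  rw [← hlaw, map_measureReal_apply_of_aemeasurable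
    (aemeasurable_pi_lambda _ fun a => (hX.1 a).aemeasurable) hset, Real.sq_sqrt zero_le_two] at hpin
  convert hpin using 4
  · ext ω
    have hn' : (0 : ℝ) < n := by positivity
    simp only [Set.mem_ofPred_eq, Set.mem_preimage]
    rw [← norm_empiricalEmbedding_sub_meanEmbedding hn, mul_le_mul_iff_right₀ hn']
  · norm_num

/-- The radius makes the exponent at least `(1 + √L)² ≥ 1 + L`, and the spare `exp (-1)` absorbs the
factor `2`. Using `n₀ ≤ n` gives one radius for graphs of all sizes. -/
theorem IsIIDSample.measureReal_le_div [IsProbabilityMeasure μ] {n n₀ : ℕ}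
    {P : Measure (EuclideanSpace ℝ (Fin d))} [IsProbabilityMeasure P]
    {X : Fin n → Ω → EuclideanSpace ℝ (Fin d)} (hX : IsIIDSample μ P X) (hn₀ : 0 < n₀)
    (hn : n₀ ≤ n) {L : ℝ} (hL : 0 ≤ L) :
    μ.real {ω | 1 / Real.sqrt n₀ * (2 + 2 * Real.sqrt L) ≤
      ‖empiricalEmbedding θ (fun a => X a ω) - meanEmbedding θ P‖} ≤ Real.exp (-L) := by
  have hn₀' : (0 : ℝ) < n₀ := by positivity
  refine (hX.measureReal_le (hn₀.trans_le hn) (by positivity)).trans ?_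
  have h₁ : (1 + Real.sqrt L) ^ 2 ≤ n * (1 / Real.sqrt n₀ * (2 + 2 * Real.sqrt L)) ^ 2 / 4 := by
    calc (1 + Real.sqrt L) ^ 2
        = n₀ * (1 / Real.sqrt n₀ * (2 + 2 * Real.sqrt L)) ^ 2 / 4 := by
          rw [mul_pow, div_pow, Real.sq_sqrt hn₀'.le]
          field_simp
          ring
      _ ≤ n * (1 / Real.sqrt n₀ * (2 + 2 * Real.sqrt L)) ^ 2 / 4 := by gcongr
  have h₂ : 1 + L ≤ (1 + Real.sqrt L) ^ 2 := by
    nlinarith [Real.sq_sqrt hL, Real.sqrt_nonneg L]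
  have h₃ : 2 ≤ Real.exp 1 := by linarith [Real.add_one_le_exp (1 : ℝ)]
  calc 2 * Real.exp (-(n * (1 / Real.sqrt n₀ * (2 + 2 * Real.sqrt L)) ^ 2 / 4))
      ≤ Real.exp 1 * Real.exp (-(1 + L)) := by
        gcongr
        linarith
    _ = Real.exp (-L) := by
        rw [← Real.exp_add]
        congr 1
        ring

/-- The distance to the own reference is below `r + s`; to any other it exceeds `2 (r + s) - (r +
s)`. -/
theorem correctlyClassified_of_norm_lt {n m K : ℕ} {P : Fin K → Measure (EuclideanSpace ℝ (Fin d))}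
    {D : Fin K → Fin m → EuclideanSpace ℝ (Fin d)} {H : Fin n → EuclideanSpace ℝ (Fin d)}
    {k : Fin K} {r s : ℝ} (hH : ‖empiricalEmbedding θ H - meanEmbedding θ (P k)‖ < s)
    (hD : ∀ j, ‖empiricalEmbedding θ (D j) - meanEmbedding θ (P j)‖ < r)
    (hsep : ∀ j, j ≠ k → 2 * (r + s) ≤ mmd θ (P k) (P j)) : CorrectlyClassified θ D H k := by
  intro j hj
  have h := hsep j hj
  have hDk := hD k
  have hDj := hD j
  rw [mmd] at h
  rw [empiricalMMD, empiricalMMD]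
  set h' := empiricalEmbedding θ H
  set x := meanEmbedding θ (P k)
  set w := meanEmbedding θ (P j)
  set u := empiricalEmbedding θ (D k)
  set v := empiricalEmbedding θ (D j)
  have h₁ : ‖h' - u‖ ≤ ‖h' - x‖ + ‖u - x‖ := by
    rw [norm_sub_rev u]
    exact norm_sub_le_norm_sub_add_norm_sub _ _ _
  have h₂ : ‖x - w‖ ≤ ‖h' - x‖ + ‖h' - v‖ + ‖v - w‖ := by
    rw [norm_sub_rev h' x]
    have h₃ := norm_sub_le_norm_sub_add_norm_sub x h' w
    have h₄ := norm_sub_le_norm_sub_add_norm_sub h' v w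
    linarith
  linarith

end GRDL

/-- `N` training graphs in `K` classes; graph `i` has label `y i` and `ν i` nodes, and the rows of
its embedding `H i` are an i.i.d. sample from the distribution `P (y i)` of its class; each
reference `D k` is an i.i.d. sample of size `m` from `P k`; nothing is assumed on the joint law of
different samples. -/
theorem theorem2 {Ω : Type*} [MeasurableSpace Ω] (μ : Measure Ω) [IsProbabilityMeasure μ]
    (d N K m n : ℕ) (θ : ℝ≥0) (hθ : 0 < θ) (δ : ℝ) (hδ : 0 < δ)
    (hKN : K ≤ N) (hm : 0 < m) (hn : 0 < n)
    (ν : Fin N → ℕ) (hν : IsLeast (Set.range ν) n)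
    (y : Fin N → Fin K)
    (P : Fin K → Measure (EuclideanSpace ℝ (Fin d))) [∀ k, IsProbabilityMeasure (P k)]
    (H : (i : Fin N) → Fin (ν i) → Ω → EuclideanSpace ℝ (Fin d))
    (hH : ∀ i, GRDL.IsIIDSample μ (P (y i)) (H i))
    (D : Fin K → Fin m → Ω → EuclideanSpace ℝ (Fin d))
    (hD : ∀ k, GRDL.IsIIDSample μ (P k) (D k))
    (hsep : ∀ i j : Fin K, i ≠ j →
      (1 / Real.sqrt m + 1 / Real.sqrt n) * (4 + 4 * Real.sqrt (Real.log (2 * N / δ)))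
        < GRDL.mmd θ (P i) (P j)) :
    1 - δ ≤ μ.real {ω | ∀ i : Fin N,
      GRDL.CorrectlyClassified θ (fun k b => D k b ω) (fun a => H i a ω) (y i)} := by
  have hN : 0 < N := by
    obtain ⟨i, -⟩ := hν.1
    exact i.pos
  rcases le_or_gt 1 δ with hδ1 | hδ1
  · exact (sub_nonpos.2 hδ1).trans measureReal_nonneg
  have hN' : (1 : ℝ) ≤ N := by exact_mod_cast hN
  -- With `δ < 1`, `L ≥ 0` and `exp (-L)` is the failure budget of one sample.
  set L : ℝ := Real.log (2 * N / δ) with hLdef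
  have hpos : 0 < 2 * N / δ := by positivity
  have hL : 0 ≤ L := Real.log_nonneg (by rw [le_div_iff₀ hδ]; linarith)
  have hexp : Real.exp (-L) = δ / (2 * N) := by
    rw [Real.exp_neg, hLdef, Real.exp_log hpos, inv_div]
  set A : Fin N → Set Ω := fun i => {ω | 1 / Real.sqrt n * (2 + 2 * Real.sqrt L) ≤
    ‖GRDL.empiricalEmbedding θ (fun a => H i a ω) - GRDL.meanEmbedding θ (P (y i))‖} with hA
  set B : Fin K → Set Ω := fun k => {ω | 1 / Real.sqrt m * (2 + 2 * Real.sqrt L) ≤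
    ‖GRDL.empiricalEmbedding θ (fun b => D k b ω) - GRDL.meanEmbedding θ (P k)‖} with hB
  set S : Set Ω := {ω | ∀ i : Fin N,
    GRDL.CorrectlyClassified θ (fun k b => D k b ω) (fun a => H i a ω) (y i)}
  -- Covering the whole space and using subadditivity avoids any measurability of `S`.
  have hcover : Set.univ ⊆ S ∪ ((⋃ i, A i) ∪ ⋃ k, B k) := by
    intro ω _
    by_contra hω
    simp only [Set.mem_union, Set.mem_iUnion, not_or, not_exists] at hω
    refine hω.1 fun i => GRDL.correctlyClassified_of_norm_lt (P := P)
      (not_le.1 (hω.2.1 i)) (fun k => not_le.1 (hω.2.2 k)) fun j hj => ?_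
    refine le_trans (le_of_eq ?_) (hsep (y i) j hj.symm).le
    ring
  have hAμ : μ.real (⋃ i, A i) ≤ N * (δ / (2 * N)) := by
    refine (measureReal_iUnion_fintype_le A).trans ?_
    refine (Finset.sum_le_sum fun i _ =>
      (hH i).measureReal_le_div hn (hν.2 ⟨i, rfl⟩) hL).trans_eq ?_
    simp [hexp]
  have hBμ : μ.real (⋃ k, B k) ≤ N * (δ / (2 * N)) := by
    refine (measureReal_iUnion_fintype_le B).trans ?_
    refine (Finset.sum_le_sum fun k _ => (hD k).measureReal_le_div hm le_rfl hL).trans ?_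
    simp only [Finset.sum_const, Finset.card_univ, Fintype.card_fin, nsmul_eq_mul, hexp]
    -- Here `K ≤ N` enters.
    gcongr
  have hone : 1 ≤ μ.real S + (μ.real (⋃ i, A i) + μ.real (⋃ k, B k)) := by
    rw [← probReal_univ (μ := μ)]
    refine (measureReal_mono hcover).trans ((measureReal_union_le _ _).trans ?_)
    gcongr
    exact measureReal_union_le _ _
  have hδN : N * (δ / (2 * N)) = δ / 2 := by field_simp
  linarith
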